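/- Let $p$ be a prime, $n\ge 1$ an integer, $R$ a commutative $\mathbb F_p$-algebra and $\lambda\in R$. Let $A=A_R^{(\lambda)}=R[T]/(T^{p^n})$ be the $R$-Hopf algebra with comultiplication $T\mapsto T\otimes 1+1\otimes T+\lambda\,T\otimes T$, counit $T\mapsto 0$ and antipode $T\mapsto -T/(1+\lambda T)$. With respect to the basis $e_i=T^i$ ($0\le i<p^n$) write $\Delta_A(e_j)=\sum_i e_i\otimes R_{ij}(e_0,\dots,e_{p^n-1})$ with $R_{ij}$ linear forms, and let $$S=S(A)_\Theta=R\Big[X_1,X_T,\dots,X_{T^{p^n-1}},\tfrac1{\varDelta}\Big],\qquad \varDelta=\det\big(R_{ij}(X_1,X_T,\dots,X_{T^{p^n-1}})\big),$$ with comultiplication $X_{T^j}\mapsto\sum_i X_{T^i}\otimes R_{ij}(X_1,X_T,\dots)$ (where $X_{T^0}=X_1$); this is the coordinate ring of the unit group scheme $U(\Gamma^{(\lambda)})$ of the group algebra of $\Gamma^{(\lambda)}=\operatorname{Spec}A$. The algebra map $j^\#:S\to A$, $X_{T^s}\mapsto T^s$, makes $S$ a right $A$-comodule algebra with coaction $\rho=(\mathrm{id}\otimes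 j^\#)\circ\Delta_S$; let $S^{\mathrm{co}A}=\{x\in S:\rho(x)=x\otimes 1\}$. For an indeterminate $\Lambda$ consider the analogous ring $S_\Lambda$ for the $\mathbb F_p$-algebra $R[\Lambda]$ and the element $\Lambda$. For $2\le s\le p^n-1$ there are elements $P_{(\Lambda)}(X_T^s)\in S_\Lambda$ determined recursively by $$P_{(\Lambda)}(X_T^s)=\frac1{\Lambda^s}\Big\{\frac{(X_1+\Lambda X_T)^sX_1}{\sum_{k=0}^s\binom sk\Lambda^kX_{T^k}}-X_1^s-\sum_{k=2}^{s-1}\binom sk\Lambda^kX_1^{s-k}P_{(\Lambda)}(X_T^k)\Big\},$$ and there is an $R$-algebra map $S_\Lambda\to S$ with $\Lambda\mapsto\lambda$ and $X_{T^s}\mapsto X_{T^s}$. Let $P_{(\lambda)}(X_T^s)\in S$ be the image of $P_{(\Lambda)}(X_T^s)$. Then there is an isomorphism of $R$-algebras $$R\Big[Z_1^{\pm1},Z_T,\dots,Z_{T^{p^n-1}},\ \frac1{Z_1^{p^n}+\lambda^{p^n}Z_T},\ \frac1{Z_1^s+\sum_{k=2}^{s-1}\binom sk\lambda^kZ_1^{s-k}Z_{T^k}+\lambda^sZ_{T^s}}\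 (2\le s\le p^n-1)\Big]\ \xrightarrow{\ \sim\ }\ S^{\mathrm{co}A}$$ given by $Z_1\mapsto X_1$, $Z_T\mapsto X_T^{p^n}$ and $Z_{T^s}\mapsto P_{(\lambda)}(X_T^s)$ for $2\le s\le p^n-1$. Here the left-hand side is the localization of the polynomial ring in $p^n$ variables $Z_1,Z_T,\dots,Z_{T^{p^n-1}}$ over $R$ at the displayed elements. -/

import Mathlib

open scoped TensorProduct

noncomputable section

/-! ## The unit group scheme of the group algebra of a finite free commutative Hopf algebra -/

namespace UnitScheme

variable {R H ι : Type*} [CommRing R] [CommRing H] [HopfAlgebra R H]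
  [Fintype ι] [DecidableEq ι] (b : Module.Basis ι R H)

/-- The elements `R_ij` of `H` determined by `Δ(e_j) = ∑ i, e_i ⊗ R_ij`. -/
def regRep : Matrix ι ι H :=
  Matrix.of fun i j =>
    TensorProduct.lid R H ((b.coord i).rTensor H (Coalgebra.comul (R := R) (b j)))

/-- The linear map `H → R[T_e : e in the basis]` with `e ↦ T_e`. -/
def gen : H →ₗ[R] MvPolynomial ι R :=
  b.constr R (fun i => (MvPolynomial.X i : MvPolynomial ι R))

/-- The matrix `(R_ij(T_{e_1}, …, T_{e_m}))`. -/
def genRegRep : Matrix ι ι (MvPolynomial ι R) :=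
  (regRep b).map (gen b)

/-- The polynomial `det (R_ij(T_{e_1}, …, T_{e_m}))`. -/
def disc : MvPolynomial ι R := (genRegRep b).det

lemma map_disc {B : Type*} [CommRing B] [Algebra R B] (f : MvPolynomial ι R →ₐ[R] B) :
    f (disc b) = (f.mapMatrix (genRegRep b)).det :=
  AlgHom.map_det f (genRegRep b)

/-- The coordinate ring `S(H)_Θ = R[T_{e_1}, …, T_{e_m}, 1 / det (R_ij(T))]` of the unit group
scheme of the group algebra of `Spec H`. -/
abbrev STheta : Type _ := Localization.Away (disc b)

/-- The linear map `H → S(H)_Θ` with `e ↦ T_e` for `e` in the basis. -/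
def genS : H →ₗ[R] STheta b :=
  (IsScalarTower.toAlgHom R (MvPolynomial ι R) (STheta b)).toLinearMap ∘ₗ gen b

lemma gen_basis (i : ι) : gen b (b i) = MvPolynomial.X i := by simp [gen]

lemma sum_tmul_coord {ι : Type*} [Fintype ι] (b : Module.Basis ι R H) (z : H ⊗[R] H) :
    ∑ i, b i ⊗ₜ[R] TensorProduct.lid R H ((b.coord i).rTensor H z) = z := by
  induction z with
  | zero => simp
  | add x y hx hy =>
    simp only [map_add, TensorProduct.tmul_add, Finset.sum_add_distrib, hx, hy]
  | tmul x y =>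
    simp only [LinearMap.rTensor_tmul, TensorProduct.lid_tmul, ← TensorProduct.smul_tmul,
      ← TensorProduct.sum_tmul, Module.Basis.coord_apply, b.sum_repr]

lemma comul_basis {ι : Type*} [Fintype ι] (b : Module.Basis ι R H) (j : ι) :
    Coalgebra.comul (R := R) (b j) = ∑ i, b i ⊗ₜ[R] regRep b i j :=
  (sum_tmul_coord b _).symm

lemma comul_regRep (i j : ι) :
    Coalgebra.comul (R := R) (regRep b i j) = ∑ k, regRep b i k ⊗ₜ[R] regRep b k j := by
  have h := LinearMap.congr_fun (Coalgebra.coassoc (R := R) (A := H)) (b j)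
  simp only [LinearMap.comp_apply, LinearEquiv.coe_coe, comul_basis, map_sum,
    LinearMap.rTensor_tmul, LinearMap.lTensor_tmul, TensorProduct.sum_tmul,
    TensorProduct.assoc_tmul] at h
  have h2 := congrArg (fun z => TensorProduct.lid R (H ⊗[R] H)
    ((b.coord i).rTensor (H ⊗[R] H) z)) h
  simp only [map_sum, LinearMap.rTensor_tmul, TensorProduct.lid_tmul, Module.Basis.coord_apply,
    Module.Basis.repr_self, Finsupp.single_apply, ite_smul, one_smul, zero_smul,
    Finset.sum_ite_eq', Finset.mem_univ, if_true] at h2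
  exact h2.symm

lemma counit_regRep (i j : ι) :
    Coalgebra.counit (R := R) (regRep b i j) = if i = j then 1 else 0 := by
  have h := LinearMap.congr_fun (Coalgebra.lTensor_counit_comp_comul (R := R) (A := H)) (b j)
  simp only [LinearMap.comp_apply, comul_basis, map_sum, LinearMap.lTensor_tmul] at h
  have h2 := congrArg (fun z => b.coord i (TensorProduct.rid R H z)) h
  simpa [Finsupp.single_apply, eq_comm] using h2

lemma isUnit_det_regRep : IsUnit (regRep b).det := by
  have h : regRep b * (regRep b).map (HopfAlgebra.antipode R) = 1 := by
    ext i j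
    have := HopfAlgebra.mul_antipode_lTensor_comul_apply (R := R) (regRep b i j)
    rw [comul_regRep, counit_regRep] at this
    simp only [map_sum, LinearMap.lTensor_tmul, LinearMap.mul'_apply] at this
    rw [Matrix.mul_apply, Matrix.one_apply]
    simp only [Matrix.map_apply, this]
    split_ifs <;> simp
  exact (Matrix.isUnit_iff_isUnit_det _).mp (IsUnit.of_mul_eq_one _ h)

/-- The comultiplication `T_{e_j} ↦ ∑ i, T_{e_i} ⊗ R_ij(T)` on `R[T_e]`, with values in
`S(H)_Θ ⊗ S(H)_Θ`. -/
def comulPoly : MvPolynomial ι R →ₐ[R] STheta b ⊗[R] STheta b :=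
  MvPolynomial.aeval fun j => ∑ i, genS b (b i) ⊗ₜ[R] genS b (regRep b i j)

lemma comulPoly_gen (h : H) :
    comulPoly b (gen b h) =
      TensorProduct.map (genS b) (genS b) (Coalgebra.comul (R := R) h) := by
  have : (comulPoly b).toLinearMap ∘ₗ gen b =
      TensorProduct.map (genS b) (genS b) ∘ₗ Coalgebra.comul (R := R) := by
    refine b.ext fun j => ?_
    simp [gen_basis, comulPoly, comul_basis]
  exact LinearMap.congr_fun this h

lemma isUnit_comulPoly_disc : IsUnit (comulPoly b (disc b)) := by
  let f₀ := IsScalarTower.toAlgHom R (MvPolynomial ι R) (STheta b)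
  let l : MvPolynomial ι R →ₐ[R] STheta b ⊗[R] STheta b :=
    Algebra.TensorProduct.includeLeft.comp f₀
  let r : MvPolynomial ι R →ₐ[R] STheta b ⊗[R] STheta b :=
    Algebra.TensorProduct.includeRight.comp f₀
  have hM : (comulPoly b).mapMatrix (genRegRep b) =
      l.mapMatrix (genRegRep b) * r.mapMatrix (genRegRep b) := by
    ext i j
    rw [Matrix.mul_apply]
    simp only [AlgHom.mapMatrix_apply, Matrix.map_apply, genRegRep, comulPoly_gen, comul_regRep,
      map_sum, TensorProduct.map_tmul]
    refine Finset.sum_congr rfl fun k _ => ?_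
    simp [l, r, f₀, genS]
  have hu : IsUnit (f₀ (disc b)) := IsLocalization.Away.algebraMap_isUnit (disc b)
  have hd : comulPoly b (disc b) = l (disc b) * r (disc b) := by
    rw [map_disc, map_disc, map_disc, hM, Matrix.det_mul]
  rw [hd]
  exact (hu.map (Algebra.TensorProduct.includeLeft (R := R) (S := R) (B := STheta b))).mul
    (hu.map (Algebra.TensorProduct.includeRight (R := R) (A := STheta b)))

/-- Extension of an `R`-algebra map `R[T_e] → B` to `S(H)_Θ`. -/
def liftS {B : Type*} [CommRing B] [Algebra R B] (f : MvPolynomial ι R →ₐ[R] B)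
    (hf : IsUnit (f (disc b))) : STheta b →ₐ[R] B :=
  IsLocalization.liftAlgHom (M := Submonoid.powers (disc b)) (f := f) (by
    rintro ⟨_, m, rfl⟩
    simpa using hf.pow m)

/-- The comultiplication of `S(H)_Θ`. -/
def comulS : STheta b →ₐ[R] STheta b ⊗[R] STheta b :=
  liftS b (comulPoly b) (isUnit_comulPoly_disc b)

lemma isUnit_aeval_disc :
    IsUnit (MvPolynomial.aeval (R := R) (fun i => b i) (disc b)) := by
  have hg : ∀ h, MvPolynomial.aeval (R := R) (fun i => b i) (gen b h) = h := fun h =>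
    LinearMap.congr_fun (b.ext (f₁ := (MvPolynomial.aeval (R := R) fun i => b i).toLinearMap ∘ₗ
      gen b) (f₂ := LinearMap.id) fun i => by simp [gen_basis]) h
  have : (MvPolynomial.aeval (R := R) fun i => b i).mapMatrix (genRegRep b) = regRep b := by
    ext i j
    simp [genRegRep, hg]
  rw [map_disc, this]
  exact isUnit_det_regRep b

/-- The algebra map `S(H)_Θ → H`, `T_e ↦ e`, of the canonical closed immersion of `Spec H` into
the unit group scheme of its group algebra. -/
def toHopf : STheta b →ₐ[R] H :=
  liftS b (MvPolynomial.aeval fun i => b i) (isUnit_aeval_disc b)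

/-- The right `H`-comodule algebra structure of `S(H)_Θ` induced by `toHopf`. -/
def coaction : STheta b →ₐ[R] STheta b ⊗[R] H :=
  (Algebra.TensorProduct.map (AlgHom.id R (STheta b)) (toHopf b)).comp (comulS b)

/-- The coinvariant subalgebra `S(H)_Θ^{co H} = {x | ρ(x) = x ⊗ 1}`. -/
def coinvariants : Subalgebra R (STheta b) :=
  AlgHom.equalizer (coaction b) Algebra.TensorProduct.includeLeft

end UnitScheme

/-! ## The Hopf algebra `A^(λ) = R[T]/(T^{p^n})` -/

section Lambda

open Polynomial

variable {R : Type*} [CommRing R] (p n : ℕ)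

/-- The ring `R[T]/(T^{p^n})`. The parameter `lam` determines the Hopf algebra structure. -/
def ALambda (_lam : R) : Type _ := AdjoinRoot ((X : R[X]) ^ p ^ n)

variable (lam : R)

instance : CommRing (ALambda p n lam) :=
  inferInstanceAs (CommRing (AdjoinRoot ((X : R[X]) ^ p ^ n)))

instance : Algebra R (ALambda p n lam) :=
  inferInstanceAs (Algebra R (AdjoinRoot ((X : R[X]) ^ p ^ n)))

namespace ALambda

/-- The class of `T`. -/
def T : ALambda p n lam := AdjoinRoot.root ((X : R[X]) ^ p ^ n)

lemma T_pow : T p n lam ^ p ^ n = 0 := by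
  have := AdjoinRoot.eval₂_root ((X : R[X]) ^ p ^ n)
  rwa [eval₂_pow, eval₂_X] at this

variable {p n lam} in
/-- The algebra map out of `R[T]/(T^{p^n})` that sends `T` to `x`. -/
def lift {B : Type*} [CommRing B] [Algebra R B] (x : B) (hx : x ^ p ^ n = 0) :
    ALambda p n lam →ₐ[R] B :=
  AdjoinRoot.liftAlgHom ((X : R[X]) ^ p ^ n) (Algebra.ofId R B) x (by
    rw [eval₂_pow, eval₂_X, hx])

variable {p n lam} in
lemma lift_T {B : Type*} [CommRing B] [Algebra R B] (x : B) (hx : x ^ p ^ n = 0) :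
    lift (lam := lam) x hx (T p n lam) = x :=
  AdjoinRoot.liftAlgHom_root _ _ _ _

variable {p n lam} in
lemma hom_ext {B : Type*} [CommRing B] [Algebra R B] {f g : ALambda p n lam →ₐ[R] B}
    (h : f (T p n lam) = g (T p n lam)) : f = g :=
  AdjoinRoot.algHom_ext (f := (X : R[X]) ^ p ^ n) h

/-- The quotient map `R[T] → R[T]/(T^{p^n})`. -/
def mk : R[X] →ₐ[R] ALambda p n lam := AdjoinRoot.mkₐ ((X : R[X]) ^ p ^ n)

/-- The representative of degree less than `p ^ n`. -/
def rep : ALambda p n lam →ₗ[R] R[X] := AdjoinRoot.modByMonicHom (monic_X_pow (R := R) (p ^ n))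

lemma mk_X : mk p n lam X = T p n lam := AdjoinRoot.mk_X

lemma mk_surjective : Function.Surjective (mk p n lam) := AdjoinRoot.mk_surjective

lemma rep_mk (q : R[X]) : rep p n lam (mk p n lam q) = q %ₘ X ^ p ^ n :=
  AdjoinRoot.modByMonicHom_mk _ q

lemma mk_rep (f : ALambda p n lam) : mk p n lam (rep p n lam f) = f :=
  AdjoinRoot.mk_leftInverse (monic_X_pow (R := R) (p ^ n)) f

lemma mk_monomial (i : ℕ) (r : R) : mk p n lam (monomial i r) = r • T p n lam ^ i := by
  rw [← smul_X_eq_monomial, map_smul, map_pow, mk_X]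

/-- The basis `1, T, …, T^{p^n - 1}`. -/
def basis [Fact p.Prime] : Module.Basis (Fin (p ^ n)) R (ALambda p n lam) :=
  .ofEquivFun
    { toFun := fun f i => (rep p n lam f).coeff i
      invFun := fun c => ∑ i, c i • T p n lam ^ (i : ℕ)
      map_add' := fun f g => by ext i; simp
      map_smul' := fun r f => by ext i; simp
      left_inv := fun f => by
        have : Subsingleton R → Subsingleton (ALambda p n lam) := fun _ =>
          Module.subsingleton R _
        rcases subsingleton_or_nontrivial R with h | h
        · exact (this h).elim _ _
        have h0 : p ^ n ≠ 0 := pow_ne_zero _ (Fact.out : p.Prime).ne_zero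
        have hm : ((X : R[X]) ^ p ^ n).Monic := monic_X_pow _
        obtain ⟨q, rfl⟩ := mk_surjective p n lam f
        have hd : (rep p n lam (mk p n lam q)).natDegree < p ^ n := by
          rw [rep_mk]
          simpa using natDegree_modByMonic_lt q hm (by
            intro h1
            exact h0 (by simpa using congrArg natDegree h1))
        conv_rhs => rw [← mk_rep p n lam (mk p n lam q), as_sum_range' _ _ hd, map_sum,
          Finset.sum_range]
        simp only [mk_monomial]
      right_inv := fun c => by
        rcases subsingleton_or_nontrivial R with h | h
        · exact Subsingleton.elim _ _
        have hm : ((X : R[X]) ^ p ^ n).Monic := monic_X_pow _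
        have hd : (∑ i : Fin (p ^ n), monomial (i : ℕ) (c i)).degree < (p ^ n : ℕ) :=
          (degree_sum_le _ _).trans_lt ((Finset.sup_lt_iff (WithBot.bot_lt_coe _)).2 fun i _ =>
            (degree_monomial_le _ _).trans_lt (by exact_mod_cast i.2))
        ext i
        simp only [← mk_monomial]
        rw [← map_sum, rep_mk, (modByMonic_eq_self_iff hm).2 (by simpa using hd)]
        simp [coeff_monomial, Fin.val_inj] }

lemma basis_apply [Fact p.Prime] (i : Fin (p ^ n)) : basis p n lam i = T p n lam ^ (i : ℕ) := by
  simp [basis, Pi.single_apply]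

lemma natCast_eq_zero [Algebra (ZMod p) R] (B : Type*) [CommRing B] [Algebra R B] :
    (p : B) = 0 := by
  have h : ((p : ℕ) : ZMod p) = 0 := ZMod.natCast_self p
  have := congrArg (fun x => algebraMap R B (algebraMap (ZMod p) R x)) h
  simpa only [map_natCast, map_zero] using this

variable [Fact p.Prime] [Algebra (ZMod p) R]

lemma add_pow_p {B : Type*} [CommRing B] [Algebra R B] (x y : B) :
    (x + y) ^ p ^ n = x ^ p ^ n + y ^ p ^ n := by
  obtain ⟨r, hr⟩ := exists_add_pow_prime_pow_eq (Fact.out : p.Prime) x y n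
  rw [hr, natCast_eq_zero (R := R) p B]
  ring

lemma comul_pow :
    (T p n lam ⊗ₜ[R] (1 : ALambda p n lam) + 1 ⊗ₜ[R] T p n lam
      + lam • (T p n lam ⊗ₜ[R] T p n lam)) ^ p ^ n = 0 := by
  have hp : p ^ n ≠ 0 := pow_ne_zero _ (Fact.out : p.Prime).ne_zero
  rw [add_pow_p (R := R), add_pow_p (R := R), _root_.smul_pow]
  simp [Algebra.TensorProduct.tmul_pow, T_pow]

/-- `T ↦ T ⊗ 1 + 1 ⊗ T + λ T ⊗ T`. -/
def comulHom : ALambda p n lam →ₐ[R] ALambda p n lam ⊗[R] ALambda p n lam :=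
  lift (T p n lam ⊗ₜ[R] (1 : ALambda p n lam) + 1 ⊗ₜ[R] T p n lam
      + lam • (T p n lam ⊗ₜ[R] T p n lam)) (comul_pow p n lam)

/-- `T ↦ 0`. -/
def counitHom : ALambda p n lam →ₐ[R] R :=
  lift 0 (zero_pow (pow_ne_zero _ (Fact.out : p.Prime).ne_zero))

lemma one_add_pow : (1 + lam • T p n lam) ^ p ^ n = 1 := by
  rw [add_pow_p (R := R), _root_.smul_pow, T_pow]; simp

lemma one_add_mul : (1 + lam • T p n lam) * (1 + lam • T p n lam) ^ (p ^ n - 1) = 1 := by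
  rw [mul_pow_sub_one (pow_ne_zero _ (Fact.out : p.Prime).ne_zero), one_add_pow]

/-- `T ↦ -T / (1 + λ T)`, where `(1 + λ T)⁻¹ = (1 + λ T) ^ (p ^ n - 1)` because
`(1 + λ T) ^ (p ^ n) = 1`. -/
def antipodeHom : ALambda p n lam →ₐ[R] ALambda p n lam :=
  lift (-(T p n lam * (1 + lam • T p n lam) ^ (p ^ n - 1))) (by
    rw [neg_pow, mul_pow, T_pow]; simp)

instance : Bialgebra R (ALambda p n lam) :=
  Bialgebra.ofAlgHom (comulHom p n lam) (counitHom p n lam)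
    (hom_ext (by
      simp [comulHom, lift_T, Algebra.TensorProduct.one_def, TensorProduct.add_tmul,
        TensorProduct.tmul_add, smul_add, TensorProduct.tmul_smul, ← TensorProduct.smul_tmul']
      abel))
    (hom_ext (by simp [comulHom, counitHom, lift_T]))
    (hom_ext (by simp [comulHom, counitHom, lift_T]))

/-- The Hopf algebra `A^(λ)`. -/
instance : HopfAlgebra R (ALambda p n lam) :=
  HopfAlgebra.ofAlgHom (antipodeHom p n lam)
    (hom_ext (by
      have h := one_add_mul p n lam
      change Algebra.TensorProduct.lift _ _ (fun _ _ => Commute.all _ _) (comulHom p n lam (T p n lam)) =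
        algebraMap R _ (counitHom p n lam (T p n lam))
      simp only [comulHom, counitHom, antipodeHom, lift_T, map_add, map_smul, map_zero,
        Algebra.TensorProduct.lift_tmul, map_one, one_mul, mul_one, AlgHom.id_apply]
      simp only [Algebra.smul_def] at h ⊢
      linear_combination (-T p n lam) * h))
    (hom_ext (by
      have h := one_add_mul p n lam
      change Algebra.TensorProduct.lift _ _ (fun _ _ => Commute.all _ _) (comulHom p n lam (T p n lam)) =
        algebraMap R _ (counitHom p n lam (T p n lam))
      simp only [comulHom, counitHom, antipodeHom, lift_T, map_add, map_smul, map_zero,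
        Algebra.TensorProduct.lift_tmul, map_one, one_mul, mul_one, AlgHom.id_apply]
      simp only [Algebra.smul_def] at h ⊢
      linear_combination (-T p n lam) * h))

end ALambda

/-- The coordinate ring `S(A^(λ))_Θ = R[X_1, X_T, …, X_{T^{p^n-1}}, 1/Δ]`. -/
abbrev SLambda [Fact p.Prime] [Algebra (ZMod p) R] : Type _ :=
  UnitScheme.STheta (ALambda.basis p n lam)

/-- The coinvariant subalgebra of `S(A^(λ))_Θ` under `A^(λ)`. -/
abbrev coinvLambda [Fact p.Prime] [Algebra (ZMod p) R] : Subalgebra R (SLambda p n lam) :=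
  UnitScheme.coinvariants (ALambda.basis p n lam)

/-- The generator `X_{T^s}` of `S(A^(λ))_Θ`, for `s < p ^ n`; here `XT 0` is `X_1`. -/
def XT [Fact p.Prime] [Algebra (ZMod p) R] (s : ℕ) : SLambda p n lam :=
  UnitScheme.genS (ALambda.basis p n lam) (ALambda.T p n lam ^ s)

/-- `∑_{k=0}^{s} binom(s,k) λ^k X_{T^k}`. -/
def ell [Fact p.Prime] [Algebra (ZMod p) R] (s : ℕ) : SLambda p n lam :=
  ∑ k ∈ Finset.range (s + 1), (s.choose k * lam ^ k : R) • XT p n lam k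

variable (R) in
/-- The family `P_(Λ)(X_T^s)`, `2 ≤ s < p ^ n`, in `R[Λ][X_1, X_T, …, 1/Δ_(Λ)]`, where
`Λ = (X : R[X])`:
`P_s = Λ^{-s} ((X_1 + Λ X_T)^s X_1 / ell_s - X_1^s - ∑_{k=2}^{s-1} binom(s,k) Λ^k X_1^{s-k} P_k)`.
Written without fractions; `Λ` is a nonzerodivisor and `ell_s` a unit, so that this determines
`P_s`. -/
def IsGenericP [Fact p.Prime] [Algebra (ZMod p) R] (P : ℕ → SLambda p n (X : R[X])) : Prop :=
  ∀ s, 2 ≤ s → s < p ^ n →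
    ((X : R[X]) ^ s) • P s * ell p n (X : R[X]) s =
      (XT p n (X : R[X]) 0 + (X : R[X]) • XT p n (X : R[X]) 1) ^ s * XT p n (X : R[X]) 0
        - (XT p n (X : R[X]) 0 ^ s
          + ∑ k ∈ Finset.Ico 2 s,
              (s.choose k * (X : R[X]) ^ k : R[X]) • (XT p n (X : R[X]) 0 ^ (s - k) * P k))
          * ell p n (X : R[X]) s

/-- `σ` is the substitution `Λ ↦ λ`, i.e. the ring map
`R[Λ][X_1, X_T, …, 1/Δ_(Λ)] → R[X_1, X_T, …, 1/Δ]` with `Λ ↦ λ` and `X_{T^s} ↦ X_{T^s}` that is the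
identity on `R`. -/
def IsSubstitution [Fact p.Prime] [Algebra (ZMod p) R]
    (σ : SLambda p n (X : R[X]) →+* SLambda p n lam) : Prop :=
  (∀ f : R[X], σ (algebraMap R[X] _ f) = algebraMap R _ (f.eval lam)) ∧
    ∀ s, s < p ^ n → σ (XT p n (X : R[X]) s) = XT p n lam s

variable (R) in
/-- The variable `Z_{T^k}` of `R[Z_1, Z_T, …, Z_{T^{p^n-1}}]`, for `k < p ^ n`; here `zvar 0` is
`Z_1`. -/
def zvar (k : ℕ) : MvPolynomial (Fin (p ^ n)) R :=
  if h : k < p ^ n then MvPolynomial.X ⟨k, h⟩ else 0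

/-- `Z_1^s + ∑_{k=2}^{s-1} binom(s,k) λ^k Z_1^{s-k} Z_{T^k} + λ^s Z_{T^s}`. -/
def zden (s : ℕ) : MvPolynomial (Fin (p ^ n)) R :=
  zvar R p n 0 ^ s
    + ∑ k ∈ Finset.Ico 2 s, (s.choose k * lam ^ k : R) • (zvar R p n 0 ^ (s - k) * zvar R p n k)
    + lam ^ s • zvar R p n s

/-- The localized polynomial ring `R[Z_1^{±1}, Z_T, …, Z_{T^{p^n-1}},
1 / (Z_1^{p^n} + λ^{p^n} Z_T), 1 / zden_s (2 ≤ s ≤ p^n - 1)]`. -/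
abbrev ZRing : Type _ :=
  Localization.Away (zvar R p n 0 * (zvar R p n 0 ^ p ^ n + lam ^ p ^ n • zvar R p n 1)
    * ∏ s ∈ Finset.Ico 2 (p ^ n), zden p n lam s)

/-- The element `Z_{T^k}` of the localized polynomial ring. -/
def ZT (k : ℕ) : ZRing p n lam := algebraMap _ _ (zvar R p n k)

end Lambda

end

/-!
`S` represents the units `a` of the algebra of functionals on `A` under convolution. Since
`1 + λT` is grouplike, each `a ↦ a ((1 + λT)^k)` is multiplicative, and `a` is a unit if and only if
all these values are. Multiplying `a⁻¹` by the functional `T^k ↦ (a(T) / a(1))^k` gives a functional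
that does not change when `a` is multiplied on the right by a point of `Γ^(λ)`; for the universal
`a`, its values on `T^s` are, up to powers of `X_1`, the elements `P_(λ)(X_T^s)`. Conversely, these
values together with `a(1)` and `a(T)` determine `a`, and `a(T)` only has to be a `p^n`-th root of
`Z_T`, so `S = ZRing[x] / (x^{p^n} - Z_T)` with `x = X_T`. The coaction is the substitution
`x ↦ x ⊗ 1 + (X_1 + λ X_T) ⊗ T`, with `X_1 + λ X_T` a unit, so a polynomial in `x` of degree less
than `p^n` is coinvariant only if it is constant.
-/

noncomputable section

open WithConv

section Convolution

variable {R C D E : Type*} [CommRing R] [AddCommGroup C] [Module R C] [Coalgebra R C]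
  [CommRing D] [Algebra R D] [CommRing E] [Algebra R E]

/-- Composition with an algebra map, as a homomorphism of convolution monoids. -/
def convMap (f : D →ₐ[R] E) : WithConv (C →ₗ[R] D) →* WithConv (C →ₗ[R] E) where
  toFun a := toConv (f.toLinearMap ∘ₗ a.ofConv)
  map_one' := by ext; simp
  map_mul' a c := WithConv.ext (LinearMap.algHom_comp_convMul_distrib f a c)

@[simp]
lemma convMap_apply (f : D →ₐ[R] E) (a : WithConv (C →ₗ[R] D)) (c : C) :
    convMap f a c = f (a c) := rfl

end Convolution

namespace UnitScheme

variable {R H ι : Type*} [CommRing R] [CommRing H] [HopfAlgebra R H]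
  (b : Module.Basis ι R H) {D E : Type*} [CommRing D] [Algebra R D] [CommRing E] [Algebra R E]

lemma aeval_gen (a : H →ₗ[R] D) (h : H) :
    MvPolynomial.aeval (R := R) (fun i => a (b i)) (gen b h) = a h :=
  LinearMap.congr_fun (b.ext (f₁ := (MvPolynomial.aeval (R := R) fun i => a (b i)).toLinearMap ∘ₗ
    gen b) (f₂ := a) fun i => by simp [gen]) h

variable [Fintype ι]

variable {b} in
lemma regRep_eq_of_comul_eq_sum {r : ι → H} {j : ι}
    (h : Coalgebra.comul (R := R) (b j) = ∑ k, b k ⊗ₜ[R] r k) (i : ι) :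
    regRep b i j = r i := by
  classical
  simp [regRep, h, Finsupp.single_apply, ite_smul]

lemma convMul_apply_basis (a c : WithConv (H →ₗ[R] D)) (j : ι) :
    (a * c) (b j) = ∑ i, a (b i) * c (regRep b i j) := by
  simp [LinearMap.convMul_apply, comul_basis]

variable [DecidableEq ι]

/-- The matrix of right multiplication by an element `a` of the convolution algebra, which is the
matrix `(a(R_ij))`. -/
def convMatrix : WithConv (H →ₗ[R] D) →* Matrix ι ι D where
  toFun a := (regRep b).map a
  map_one' := by
    ext i j
    simp [LinearMap.convOne_apply, counit_regRep, Matrix.one_apply, apply_ite (algebraMap R D)]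
  map_mul' a c := by
    ext i j
    simp [LinearMap.convMul_apply, comul_regRep, Matrix.mul_apply]

lemma convMatrix_apply (a : WithConv (H →ₗ[R] D)) : convMatrix b a = (regRep b).map a := rfl

lemma apply_basis_eq_vecMul (a : WithConv (H →ₗ[R] D)) (j : ι) :
    a (b j) = Matrix.vecMul (fun i => (1 : WithConv (H →ₗ[R] D)) (b i)) (convMatrix b a) j := by
  conv_lhs => rw [← one_mul a, convMul_apply_basis]
  rfl

lemma convMatrix_injective : Function.Injective (convMatrix (D := D) b) := fun a c h =>
  WithConv.ext (b.ext fun j => by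
    have := apply_basis_eq_vecMul b a j
    rw [h, ← apply_basis_eq_vecMul b c j] at this
    exact this)

lemma isUnit_iff_isUnit_det_convMatrix (a : WithConv (H →ₗ[R] D)) :
    IsUnit a ↔ IsUnit (convMatrix b a).det := by
  refine ⟨fun h => (Matrix.isUnit_iff_isUnit_det _).1 (h.map (convMatrix b)), fun h => ?_⟩
  let ε : ι → D := fun i => (1 : WithConv (H →ₗ[R] D)) (b i)
  let c : WithConv (H →ₗ[R] D) := toConv (b.constr R (Matrix.vecMul ε (convMatrix b a)⁻¹))
  have hc : (fun i => c (b i)) = Matrix.vecMul ε (convMatrix b a)⁻¹ := by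
    ext i
    simp [c]
  have hca : c * a = 1 := WithConv.ext (b.ext fun j => by
    have h1 : (c * a) (b j) = Matrix.vecMul (fun i => c (b i)) (convMatrix b a) j :=
      convMul_apply_basis b c a j
    rw [hc, Matrix.vecMul_vecMul, Matrix.nonsing_inv_mul _ h, Matrix.vecMul_one] at h1
    exact h1)
  have hac : a * c = 1 := convMatrix_injective b (by
    rw [map_mul, map_one, mul_eq_one_comm, ← map_mul, hca, map_one])
  exact ⟨⟨a, c, hac, hca⟩, rfl⟩

lemma det_convMatrix_genS : (convMatrix b (toConv (genS b))).det = algebraMap _ _ (disc b) := by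
  change _ = IsScalarTower.toAlgHom R (MvPolynomial ι R) (STheta b) (disc b)
  rw [map_disc]
  rfl

/-- The tautological unit of the group algebra over `S(H)_Θ`. -/
def genUnit : (WithConv (H →ₗ[R] STheta b))ˣ :=
  ((isUnit_iff_isUnit_det_convMatrix b (toConv (genS b))).2 (by
    rw [det_convMatrix_genS]
    exact IsLocalization.Away.algebraMap_isUnit (disc b))).unit

lemma coe_genUnit : (genUnit b : WithConv (H →ₗ[R] STheta b)) = toConv (genS b) := rfl

lemma liftS_genS (f : MvPolynomial ι R →ₐ[R] D) (hf : IsUnit (f (disc b))) (h : H) :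
    liftS b f hf (genS b h) = f (gen b h) := by
  simp [liftS, genS]

/-- The point of the unit group scheme given by a unit of the group algebra over `D`. -/
def liftUnit (a : (WithConv (H →ₗ[R] D))ˣ) : STheta b →ₐ[R] D :=
  liftS b (MvPolynomial.aeval fun i => (a : WithConv (H →ₗ[R] D)) (b i)) (by
    convert (isUnit_iff_isUnit_det_convMatrix b _).1 a.isUnit using 1
    rw [map_disc]
    congr 1
    ext i j
    exact aeval_gen b (a : WithConv (H →ₗ[R] D)).ofConv (regRep b i j))

lemma liftUnit_genS (a : (WithConv (H →ₗ[R] D))ˣ) (h : H) :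
    liftUnit b a (genS b h) = a.val h := by
  rw [liftUnit, liftS_genS]
  exact aeval_gen b a.val.ofConv h

lemma map_liftUnit_genUnit (a : (WithConv (H →ₗ[R] D))ˣ) :
    Units.map (convMap (liftUnit b a)) (genUnit b) = a :=
  Units.ext (WithConv.ext (LinearMap.ext (liftUnit_genS b a)))

lemma algHom_ext_of_genUnit {f g : STheta b →ₐ[R] D}
    (h : Units.map (convMap f) (genUnit b) = Units.map (convMap g) (genUnit b)) : f = g := by
  refine IsLocalization.algHom_ext (Submonoid.powers (disc b)) (MvPolynomial.algHom_ext fun i => ?_)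
  have := congrArg (fun u : (WithConv (H →ₗ[R] D))ˣ => u.val (b i)) h
  simp only [Units.coe_map, convMap_apply, coe_genUnit, genS, LinearMap.comp_apply,
    gen_basis] at this
  exact this

lemma convMap_coaction_genUnit :
    convMap (coaction b) (genUnit b).val =
      convMap Algebra.TensorProduct.includeLeft (genUnit b).val *
        toConv (Algebra.TensorProduct.includeRight : H →ₐ[R] STheta b ⊗[R] H).toLinearMap := by
  have toHopf_genS (h : H) : toHopf b (genS b h) = h := by
    rw [toHopf, liftS_genS]
    exact aeval_gen b LinearMap.id h
  refine WithConv.ext (b.ext fun j => ?_)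
  change coaction b (genS b (b j)) = _
  rw [coaction, AlgHom.comp_apply, comulS, liftS_genS, comulPoly_gen, comul_basis]
  refine Eq.trans ?_ (convMul_apply_basis b _ _ j).symm
  simp [coe_genUnit, toHopf_genS]

end UnitScheme

namespace ALambda

section ConvolutionUnits

variable {R : Type*} [CommRing R] (p n : ℕ) (lam : R)

/-- The element `1 + λ T`, which is grouplike. -/
def g : ALambda p n lam := 1 + lam • T p n lam

variable {p n lam} in
lemma apply_g_pow {M : Type*} [AddCommGroup M] [Module R M] (a : ALambda p n lam →ₗ[R] M)
    (k : ℕ) :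
    a (g p n lam ^ k) =
      ∑ i ∈ Finset.range (k + 1), (k.choose i * lam ^ i : R) • a (T p n lam ^ i) := by
  rw [g, add_comm, add_pow, map_sum]
  refine Finset.sum_congr rfl fun i _ => ?_
  rw [← map_smul]
  congr 1
  simp only [one_pow, mul_one, Algebra.smul_def, mul_pow, map_mul, map_natCast, map_pow]
  ring

variable [Fact p.Prime]

lemma basis_mk {k : ℕ} (hk : k < p ^ n) : basis p n lam ⟨k, hk⟩ = T p n lam ^ k :=
  basis_apply p n lam _

section Bialgebra

variable [Algebra (ZMod p) R]

lemma comul_T : Coalgebra.comul (R := R) (T p n lam) =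
    T p n lam ⊗ₜ[R] g p n lam + 1 ⊗ₜ[R] T p n lam := by
  change comulHom p n lam (T p n lam) = _
  rw [comulHom, lift_T, g, TensorProduct.tmul_add, TensorProduct.tmul_smul]
  abel

lemma counit_T : Coalgebra.counit (R := R) (T p n lam) = 0 :=
  lift_T (lam := lam) 0 (zero_pow (pow_ne_zero n (Fact.out : p.Prime).ne_zero))

lemma comul_g : Coalgebra.comul (R := R) (g p n lam) = g p n lam ⊗ₜ[R] g p n lam := by
  conv_lhs => rw [g, map_add, map_smul, comul_T, Bialgebra.comul_one]
  rw [smul_add, TensorProduct.smul_tmul', ← TensorProduct.tmul_smul,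
    Algebra.TensorProduct.one_def, add_left_comm, ← TensorProduct.tmul_add, ← g,
    ← TensorProduct.add_tmul, add_comm, ← g]

lemma comul_g_pow (k : ℕ) : Coalgebra.comul (R := R) (g p n lam ^ k) =
    (g p n lam ^ k) ⊗ₜ[R] (g p n lam ^ k) := by
  rw [Bialgebra.comul_pow, comul_g, Algebra.TensorProduct.tmul_pow]

lemma comul_T_pow (j : ℕ) : Coalgebra.comul (R := R) (T p n lam ^ j) =
    ∑ i ∈ Finset.range (j + 1),
      (T p n lam ^ i) ⊗ₜ[R] ((j.choose i : R) • (g p n lam ^ i * T p n lam ^ (j - i))) := by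
  rw [Bialgebra.comul_pow, comul_T, add_pow]
  refine Finset.sum_congr rfl fun i _ => ?_
  rw [TensorProduct.tmul_smul]
  simp only [Algebra.TensorProduct.tmul_pow, Algebra.TensorProduct.tmul_mul_tmul, one_pow, mul_one,
    Algebra.smul_def, map_natCast]
  ring

variable {p n lam} in
lemma regRep_basis_of_comul_T_pow {r : ℕ → ALambda p n lam} {j : Fin (p ^ n)}
    (h : Coalgebra.comul (R := R) (T p n lam ^ (j : ℕ)) =
      ∑ k ∈ Finset.range (j + 1), (T p n lam ^ k) ⊗ₜ[R] r k)
    (hr : ∀ k > (j : ℕ), r k = 0) (i : Fin (p ^ n)) :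
    UnitScheme.regRep (basis p n lam) i j = r i := by
  refine UnitScheme.regRep_eq_of_comul_eq_sum (r := fun k : Fin (p ^ n) => r k) ?_ i
  calc Coalgebra.comul (R := R) (basis p n lam j)
      = ∑ k ∈ Finset.range (j + 1), (T p n lam ^ k) ⊗ₜ[R] r k := by rw [basis_apply, h]
    _ = ∑ k ∈ Finset.range (p ^ n), (T p n lam ^ k) ⊗ₜ[R] r k := by
      refine Finset.sum_subset (Finset.range_subset_range.2 j.2) fun k _ hk => ?_
      rw [hr k (by simpa using hk), TensorProduct.tmul_zero]
    _ = ∑ k : Fin (p ^ n), basis p n lam k ⊗ₜ[R] r k := by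
      simp only [basis_apply]
      exact (Fin.sum_univ_eq_sum_range (fun k => (T p n lam ^ k) ⊗ₜ[R] r k) _).symm

lemma regRep_basis (i j : Fin (p ^ n)) : UnitScheme.regRep (basis p n lam) i j =
    ((j : ℕ).choose i : R) • (g p n lam ^ (i : ℕ) * T p n lam ^ (j - i : ℕ)) :=
  regRep_basis_of_comul_T_pow (comul_T_pow p n lam j)
    (fun k hk => by rw [Nat.choose_eq_zero_of_lt hk, Nat.cast_zero, zero_smul]) i

end Bialgebra

/-- The group algebra of `Γ^(λ) = Spec A^(λ)` over an `R`-algebra `D`, namely the linear dual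
of `A^(λ)` with coefficients in `D` under convolution. -/
abbrev GroupAlgebra (D : Type*) [CommRing D] [Algebra R D] : Type _ :=
  WithConv (ALambda p n lam →ₗ[R] D)

variable {p n lam}
variable {D E : Type*} [CommRing D] [Algebra R D] [CommRing E] [Algebra R E]

lemma conv_ext {a c : GroupAlgebra p n lam D}
    (h : ∀ k < p ^ n, a (T p n lam ^ k) = c (T p n lam ^ k)) : a = c :=
  WithConv.ext ((basis p n lam).ext fun i => by
    rw [basis_apply]
    exact h i i.2)

variable (p n lam) in
/-- The element of the group algebra that sends `T ^ k` to `w k` for `k < p ^ n`. -/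
def ofValues (w : ℕ → D) : GroupAlgebra p n lam D :=
  toConv ((basis p n lam).constr R fun i => w i)

lemma ofValues_T_pow (w : ℕ → D) {k : ℕ} (hk : k < p ^ n) :
    ofValues p n lam w (T p n lam ^ k) = w k := by
  rw [← basis_mk p n lam hk]
  simp [ofValues]

lemma ofValues_one (w : ℕ → D) : ofValues p n lam w 1 = w 0 := by
  simpa using ofValues_T_pow (lam := lam) w (pow_pos (Fact.out : p.Prime).pos n)

lemma ofValues_T [NeZero n] (w : ℕ → D) : ofValues p n lam w (T p n lam) = w 1 := by
  simpa using ofValues_T_pow (lam := lam) w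
    (Nat.one_lt_pow (NeZero.ne n) (Fact.out : p.Prime).one_lt)

variable (p n lam) in
/-- The element of the group algebra that sends `T ^ k` to `u ^ k` for `k < p ^ n`. If
`u ^ p ^ n = 0`, it is the point of `Γ^(λ)` with coordinate `u`. -/
def powConv (u : D) : GroupAlgebra p n lam D :=
  ofValues p n lam (u ^ ·)

lemma powConv_T_pow (u : D) {k : ℕ} (hk : k < p ^ n) :
    powConv p n lam u (T p n lam ^ k) = u ^ k :=
  ofValues_T_pow _ hk

lemma powConv_one (u : D) : powConv p n lam u 1 = 1 :=
  (ofValues_one _).trans (pow_zero u)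

lemma powConv_T [NeZero n] (u : D) : powConv p n lam u (T p n lam) = u :=
  (ofValues_T _).trans (pow_one u)

lemma powConv_g_pow (u : D) {k : ℕ} (hk : k < p ^ n) :
    powConv p n lam u (g p n lam ^ k) = (1 + lam • u) ^ k := by
  rw [apply_g_pow, add_comm 1, add_pow]
  refine Finset.sum_congr rfl fun i hi => ?_
  rw [powConv_T_pow u ((Nat.lt_succ_iff.1 (Finset.mem_range.1 hi)).trans_lt hk)]
  simp only [one_pow, mul_one, Algebra.smul_def, mul_pow, map_mul, map_natCast, map_pow]
  ring

lemma powConv_of_pow_eq_zero {t : D} (ht : t ^ p ^ n = 0) :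
    powConv p n lam t = toConv (lift t ht : ALambda p n lam →ₐ[R] D).toLinearMap :=
  conv_ext fun k hk => by simp [powConv_T_pow t hk, lift_T]

variable [Algebra (ZMod p) R]

lemma conv_apply_T_pow (a c : GroupAlgebra p n lam D) (j : ℕ) :
    (a * c) (T p n lam ^ j) = ∑ i ∈ Finset.range (j + 1),
      (j.choose i : D) * (a (T p n lam ^ i) * c (g p n lam ^ i * T p n lam ^ (j - i))) := by
  rw [LinearMap.convMul_apply, comul_T_pow, map_sum, map_sum]
  refine Finset.sum_congr rfl fun i _ => ?_
  rw [TensorProduct.tmul_smul, map_smul, map_smul, Algebra.smul_def, map_natCast]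
  simp

lemma conv_apply_T (a c : GroupAlgebra p n lam D) :
    (a * c) (T p n lam) = a (T p n lam) * c (g p n lam) + a 1 * c (T p n lam) := by
  simp [LinearMap.convMul_apply, comul_T]

lemma conv_apply_g_pow (a c : GroupAlgebra p n lam D) (k : ℕ) :
    (a * c) (g p n lam ^ k) = a (g p n lam ^ k) * c (g p n lam ^ k) := by
  rw [LinearMap.convMul_apply, comul_g_pow]
  simp

lemma conv_apply_one (a c : GroupAlgebra p n lam D) : (a * c) 1 = a 1 * c 1 := by
  simpa using conv_apply_g_pow a c 0

lemma one_apply_one : (1 : GroupAlgebra p n lam D) 1 = 1 := by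
  simp [LinearMap.convOne_apply]

lemma one_apply_T : (1 : GroupAlgebra p n lam D) (T p n lam) = 0 := by
  simp [LinearMap.convOne_apply, counit_T]

lemma isUnit_iff (a : GroupAlgebra p n lam D) :
    IsUnit a ↔ ∀ k < p ^ n, IsUnit (a (g p n lam ^ k)) := by
  have det_eq : (UnitScheme.convMatrix (basis p n lam) a).det =
      ∏ i : Fin (p ^ n), a (g p n lam ^ (i : ℕ)) := by
    rw [Matrix.det_of_isUpperTriangular]
    · simp [UnitScheme.convMatrix_apply, regRep_basis]
    · intro i j hij
      rw [UnitScheme.convMatrix_apply, Matrix.map_apply, regRep_basis,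
        Nat.choose_eq_zero_of_lt (show (j : ℕ) < i from hij)]
      simp
  rw [UnitScheme.isUnit_iff_isUnit_det_convMatrix (basis p n lam), det_eq, IsUnit.prod_univ_iff,
    Fin.forall_iff]

lemma isUnit_powConv {u : D} (hu : IsUnit (1 + lam • u)) : IsUnit (powConv p n lam u) :=
  (isUnit_iff _).2 fun k hk => by
    rw [powConv_g_pow u hk]
    exact hu.pow k

/-- The group law `(r, t) ↦ r + t + λ r t` of `Γ^(λ)` holds for `powConv r` even when `r` is not
nilpotent. -/
lemma powConv_mul_powConv (r : D) {t : D} (ht : t ^ p ^ n = 0) :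
    powConv p n lam r * powConv p n lam t = powConv p n lam (r * (1 + lam • t) + t) :=
  conv_ext fun j hj => by
    rw [powConv_T_pow _ hj, conv_apply_T_pow, add_pow]
    refine Finset.sum_congr rfl fun i hi => ?_
    have hi : i < p ^ n := (Nat.lt_succ_iff.1 (Finset.mem_range.1 hi)).trans_lt hj
    rw [powConv_T_pow r hi, powConv_of_pow_eq_zero ht]
    simp only [AlgHom.toLinearMap_apply, map_mul, map_pow, g, map_add, map_one, map_smul, lift_T,
      mul_pow]
    ring

end ConvolutionUnits

section Coordinates

variable {R : Type*} [CommRing R] {p n : ℕ} {lam : R}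
  {D E : Type*} [CommRing D] [Algebra R D] [CommRing E] [Algebra R E]

variable (lam) in
/-- The polynomial `zden` evaluated at a sequence `z` of elements of an algebra. -/
def den (z : ℕ → D) (s : ℕ) : D :=
  z 0 ^ s + ∑ k ∈ Finset.Ico 2 s, (s.choose k * lam ^ k : R) • (z 0 ^ (s - k) * z k)
    + lam ^ s • z s

lemma map_den (f : D →ₐ[R] E) (z : ℕ → D) (s : ℕ) : f (den lam z s) = den lam (f ∘ z) s := by
  simp [den]

lemma den_congr {z z' : ℕ → D} {s : ℕ} (h : ∀ k ≤ s, z k = z' k) : den lam z s = den lam z' s := by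
  rw [den, den, h 0 s.zero_le, h s le_rfl]
  congr 2
  refine Finset.sum_congr rfl fun k hk => ?_
  rw [h k (Finset.mem_Ico.1 hk).2.le]

/-- The element `q` of the group algebra sends `1` to `1 / z 0`, `T` to `0` and `T ^ k` to
`z k / z 0 ^ (k + 1)` for `2 ≤ k < p ^ n`; there is no condition on `z 1`. The units `quot a` below
are of this form. -/
structure HasCoords (q : WithConv (ALambda p n lam →ₗ[R] D)) (z : ℕ → D) : Prop where
  mul_apply_one : z 0 * q 1 = 1
  apply_T : q (T p n lam) = 0
  eq_mul_apply : ∀ k, 2 ≤ k → k < p ^ n → z k = z 0 ^ (k + 1) * q (T p n lam ^ k)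

namespace HasCoords

variable {q q' : WithConv (ALambda p n lam →ₗ[R] D)} {z z' : ℕ → D}

lemma mul_apply_g (h : HasCoords q z) : z 0 * q (g p n lam) = 1 := by
  rw [g, map_add, map_smul, h.apply_T, smul_zero, add_zero, h.mul_apply_one]

lemma den_eq (h : HasCoords q z) {s : ℕ} (hs : 2 ≤ s) (hsN : s < p ^ n) :
    den lam z s = z 0 ^ (s + 1) * q (g p n lam ^ s) := by
  have term (k : ℕ) (hk : k ∈ Finset.Ico 2 (s + 1)) :
      (s.choose k * lam ^ k : R) • (z 0 ^ (s - k) * z k) =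
        z 0 ^ (s + 1) * ((s.choose k * lam ^ k : R) • q (T p n lam ^ k)) := by
    obtain ⟨hk, hks⟩ := Finset.mem_Ico.1 hk
    rw [h.eq_mul_apply k hk (by omega), mul_smul_comm, ← mul_assoc, ← pow_add,
      show s - k + (k + 1) = s + 1 by omega]
  calc den lam z s
      = z 0 ^ s + ∑ k ∈ Finset.Ico 2 (s + 1),
          (s.choose k * lam ^ k : R) • (z 0 ^ (s - k) * z k) := by
        rw [den, Finset.sum_Ico_succ_top hs, add_assoc]
        simp
    _ = z 0 ^ (s + 1) * q 1 + z 0 ^ (s + 1) * ∑ k ∈ Finset.Ico 2 (s + 1),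
          ((s.choose k * lam ^ k : R) • q (T p n lam ^ k)) := by
        rw [Finset.sum_congr rfl term, Finset.mul_sum, pow_succ, mul_assoc (z 0 ^ s) (z 0) (q 1),
          h.mul_apply_one, mul_one]
    _ = z 0 ^ (s + 1) * q (g p n lam ^ s) := by
        rw [apply_g_pow, Finset.range_eq_Ico,
          Finset.sum_eq_sum_Ico_succ_bot (show 0 < s + 1 by omega),
          Finset.sum_eq_sum_Ico_succ_bot (show 0 + 1 < s + 1 by omega)]
        simp [h.apply_T, mul_add]

variable [Fact p.Prime]

lemma eq_of_coords_eq (h : HasCoords q z) (h' : HasCoords q' z')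
    (hz : ∀ k < p ^ n, k ≠ 1 → z k = z' k) : q = q' := by
  have h0 : z 0 = z' 0 := hz 0 (pow_pos (Fact.out : p.Prime).pos n) zero_ne_one
  have hu : IsUnit (z 0) := .of_mul_eq_one _ h.mul_apply_one
  refine conv_ext fun k hk => ?_
  match k with
  | 0 =>
    rw [pow_zero]
    exact hu.mul_left_cancel (by rw [h.mul_apply_one, h0, h'.mul_apply_one])
  | 1 => rw [pow_one, h.apply_T, h'.apply_T]
  | k + 2 =>
    refine (hu.pow (k + 2 + 1)).mul_left_cancel ?_
    rw [← h.eq_mul_apply _ (by omega) hk, hz _ hk (by omega), h0,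
      h'.eq_mul_apply _ (by omega) hk]

lemma exists_of_isUnit [NeZero n] (h0 : IsUnit (z 0)) :
    ∃ q : GroupAlgebra p n lam D, HasCoords q z := by
  obtain ⟨v, hv⟩ := h0.exists_right_inv
  let w : ℕ → D
    | 0 => v
    | 1 => 0
    | k + 2 => v ^ (k + 3) * z (k + 2)
  refine ⟨ofValues p n lam w, by rw [ofValues_one, hv], ofValues_T w, fun k hk hkN => ?_⟩
  obtain ⟨k, rfl⟩ := Nat.exists_eq_add_of_le' hk
  rw [ofValues_T_pow w hkN, ← mul_assoc, ← mul_pow, hv, one_pow, one_mul]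

end HasCoords

section Coord

variable [Fact p.Prime] [Algebra (ZMod p) R]

/-- The point `X_T / X_1` of the affine line, moved by the group law of `Γ^(λ)` when the unit is
multiplied by a point of `Γ^(λ)`. -/
def ratio (a : (GroupAlgebra p n lam D)ˣ) : D := a.val (T p n lam) * a.inv 1

/-- The invariant `quot a` of a unit `a` under right multiplication by points of `Γ^(λ)`. -/
def quot (a : (GroupAlgebra p n lam D)ˣ) : GroupAlgebra p n lam D :=
  powConv p n lam (ratio a) * a.inv

/-- The images in `D` of the generators `Z_{T^k}` under the point of the unit group scheme given by
a unit of the group algebra over `D`. -/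
def coord (a : (GroupAlgebra p n lam D)ˣ) : ℕ → D
  | 0 => a.val 1
  | 1 => a.val (T p n lam) ^ p ^ n
  | k + 2 => a.val 1 ^ (k + 3) * quot a (T p n lam ^ (k + 2))

lemma apply_one_mul_inv_apply_one (a : (GroupAlgebra p n lam D)ˣ) : a.val 1 * a.inv 1 = 1 := by
  rw [← conv_apply_one, a.val_inv, one_apply_one]

lemma ratio_mul_apply_one (a : (GroupAlgebra p n lam D)ˣ) :
    ratio a * a.val 1 = a.val (T p n lam) := by
  rw [ratio, mul_assoc, mul_comm (a.inv 1), apply_one_mul_inv_apply_one, mul_one]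

lemma ratio_eq_of_mul_apply_one {a : (GroupAlgebra p n lam D)ˣ} {r : D}
    (h : r * a.val 1 = a.val (T p n lam)) : ratio a = r := by
  rw [ratio, ← h, mul_assoc, apply_one_mul_inv_apply_one, mul_one]

lemma apply_one_add_smul_apply_T (a : (GroupAlgebra p n lam D)ˣ) :
    a.val 1 + lam • a.val (T p n lam) = a.val 1 * (1 + lam • ratio a) := by
  rw [← ratio_mul_apply_one a, mul_add, mul_one, mul_smul_comm, mul_comm (ratio a)]

lemma isUnit_apply_one (a : (GroupAlgebra p n lam D)ˣ) : IsUnit (a.val 1) :=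
  .of_mul_eq_one _ (apply_one_mul_inv_apply_one a)

lemma isUnit_apply_g_pow (a : (GroupAlgebra p n lam D)ˣ) {k : ℕ} (hk : k < p ^ n) :
    IsUnit (a.val (g p n lam ^ k)) :=
  (isUnit_iff a.val).1 a.isUnit k hk

variable [NeZero n]

lemma hasCoords_quot (a : (GroupAlgebra p n lam D)ˣ) : HasCoords (quot a) (coord a) where
  mul_apply_one := by
    rw [quot, conv_apply_one, powConv_one, one_mul]
    exact apply_one_mul_inv_apply_one a
  apply_T := by
    have h : a.val (T p n lam) * a.inv (g p n lam) + a.val 1 * a.inv (T p n lam) = 0 := by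
      rw [← conv_apply_T, a.val_inv, one_apply_T]
    rw [quot, conv_apply_T, powConv_T, powConv_one, one_mul]
    refine (isUnit_apply_one a).mul_left_cancel ?_
    rw [mul_zero, ← h, mul_add, ← mul_assoc, mul_comm (a.val 1), ratio_mul_apply_one]
  eq_mul_apply
    | k + 2, _, _ => rfl

lemma isUnit_apply_one_add_smul_apply_T (a : (GroupAlgebra p n lam D)ˣ) :
    IsUnit (a.val 1 + lam • a.val (T p n lam)) := by
  rw [← map_smul, ← map_add, ← g, ← pow_one (g p n lam)]
  exact isUnit_apply_g_pow a (Nat.one_lt_pow (NeZero.ne n) (Fact.out : p.Prime).one_lt)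

lemma den_coord_mul_apply_g_pow (a : (GroupAlgebra p n lam D)ˣ) {s : ℕ} (hs : 2 ≤ s)
    (hsN : s < p ^ n) :
    den lam (coord a) s * a.val (g p n lam ^ s) =
      (a.val 1 + lam • a.val (T p n lam)) ^ s * a.val 1 := by
  have quot_mul : quot a * a.val = powConv p n lam (ratio a) := by
    rw [quot, mul_assoc, a.inv_val, mul_one]
  rw [(hasCoords_quot a).den_eq hs hsN, mul_assoc, ← conv_apply_g_pow, quot_mul,
    powConv_g_pow _ hsN, apply_one_add_smul_apply_T, mul_pow]
  change a.val 1 ^ (s + 1) * _ = _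
  ring

lemma isUnit_powConv_ratio (a : (GroupAlgebra p n lam D)ˣ) :
    IsUnit (powConv p n lam (ratio a)) := by
  have h := isUnit_apply_one_add_smul_apply_T a
  rw [apply_one_add_smul_apply_T] at h
  exact isUnit_powConv (isUnit_of_mul_isUnit_right h)

lemma eq_of_coord_eq {a c : (GroupAlgebra p n lam D)ˣ}
    (hT : a.val (T p n lam) = c.val (T p n lam)) (h : ∀ k < p ^ n, coord a k = coord c k) :
    a = c := by
  have hone : a.val 1 = c.val 1 := h 0 (pow_pos (Fact.out : p.Prime).pos n)
  have hratio : ratio a = ratio c :=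
    ratio_eq_of_mul_apply_one (by rw [hone, ratio_mul_apply_one, hT])
  have hquot : quot a = quot c :=
    (hasCoords_quot a).eq_of_coords_eq (hasCoords_quot c) fun k hk _ => h k hk
  rw [quot, quot, ← hratio] at hquot
  exact inv_injective (Units.ext ((isUnit_powConv_ratio a).mul_left_cancel hquot))

lemma coord_mul_powConv (a : (GroupAlgebra p n lam D)ˣ) {t : D} (ht : t ^ p ^ n = 0)
    {χ : (GroupAlgebra p n lam D)ˣ} (hχ : χ.val = powConv p n lam t) :
    coord (a * χ) = coord a := by
  have hχone : χ.val 1 = 1 := by rw [hχ, powConv_one]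
  have hone : (a * χ).val 1 = a.val 1 := by
    rw [Units.val_mul, conv_apply_one, hχone, mul_one]
  have hT : (a * χ).val (T p n lam) = a.val (T p n lam) * (1 + lam • t) + a.val 1 * t := by
    rw [Units.val_mul, conv_apply_T, g, map_add, map_smul, hχone, hχ, powConv_T]
  have hratio : ratio (a * χ) = ratio a * (1 + lam • t) + t :=
    ratio_eq_of_mul_apply_one (by
      rw [hone, hT, ← ratio_mul_apply_one a]
      ring)
  have hquot : quot (a * χ) = quot a := by
    rw [quot, hratio, ← powConv_mul_powConv _ ht, ← hχ]
    change _ * _ * (a * χ)⁻¹.val = _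
    rw [mul_inv_rev, Units.val_mul, mul_assoc, Units.mul_inv_cancel_left]
    rfl
  funext k
  match k with
  | 0 => exact hone
  | 1 =>
    change (a * χ).val (T p n lam) ^ p ^ n = a.val (T p n lam) ^ p ^ n
    rw [hT, add_pow_p (R := R), mul_pow, mul_pow, ht, mul_zero, add_zero, add_pow_p (R := R),
      _root_.smul_pow, ht, smul_zero, one_pow, add_zero, mul_one]
  | k + 2 => simp only [coord, hone, hquot]

end Coord

end Coordinates

section Admissible

variable {R R' : Type*} [CommRing R] [CommRing R'] {p n : ℕ} {lam : R} {lam' : R'}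
  {D E : Type*} [CommRing D] [Algebra R D] [CommRing E]

variable (p n lam) in
/-- The sequence `z` defines a point of the spectrum of `ZRing`: the elements inverted there become
units at `z`. -/
structure IsAdmissible (z : ℕ → D) : Prop where
  isUnit_zero : IsUnit (z 0)
  isUnit_zero_pow_add : IsUnit (z 0 ^ p ^ n + lam ^ p ^ n • z 1)
  isUnit_den : ∀ s, 2 ≤ s → s < p ^ n → IsUnit (den lam z s)

lemma IsAdmissible.map [Algebra R E] {z : ℕ → D} (h : IsAdmissible p n lam z) (f : D →ₐ[R] E) :
    IsAdmissible p n lam (f ∘ z) where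
  isUnit_zero := h.isUnit_zero.map f
  isUnit_zero_pow_add := by simpa using h.isUnit_zero_pow_add.map f
  isUnit_den s hs hsN := map_den f z s ▸ (h.isUnit_den s hs hsN).map f

variable [Fact p.Prime]

lemma HasCoords.isUnit [Algebra (ZMod p) R] {q : GroupAlgebra p n lam D} {z : ℕ → D}
    (h : HasCoords q z) (hz : IsAdmissible p n lam z) : IsUnit q :=
  (isUnit_iff q).2 fun k hk => by
    match k with
    | 0 =>
      rw [pow_zero]
      exact .of_mul_eq_one_right _ h.mul_apply_one
    | 1 =>
      rw [pow_one]
      exact .of_mul_eq_one_right _ h.mul_apply_g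
    | k + 2 =>
      refine isUnit_of_mul_isUnit_right (x := z 0 ^ (k + 2 + 1)) ?_
      rw [← h.den_eq (by omega) hk]
      exact hz.isUnit_den _ (by omega) hk

variable [Algebra (ZMod p) R]

lemma isAdmissible_coord [NeZero n] (a : (GroupAlgebra p n lam D)ˣ) :
    IsAdmissible p n lam (coord a) where
  isUnit_zero := isUnit_apply_one a
  isUnit_zero_pow_add := by
    have h := (isUnit_apply_one_add_smul_apply_T a).pow (p ^ n)
    rwa [add_pow_p (R := R), _root_.smul_pow] at h
  isUnit_den s hs hsN := by
    have h := den_coord_mul_apply_g_pow a hs hsN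
    exact isUnit_of_mul_isUnit_left
      (h ▸ ((isUnit_apply_one_add_smul_apply_T a).pow s).mul (isUnit_apply_one a))

namespace HasCoords

variable {q r : (GroupAlgebra p n lam D)ˣ} {z : ℕ → D} {x : D}

lemma inv_mul_apply_one (hq : HasCoords q.val z) (hr : r.val = powConv p n lam (x * q.val 1)) :
    (q⁻¹ * r).val 1 = z 0 := by
  have h := conv_apply_one q.val (q⁻¹ * r).val
  rw [← Units.val_mul, mul_inv_cancel_left, hr, powConv_one] at h
  linear_combination (-z 0) * h - (q⁻¹ * r).val 1 * hq.mul_apply_one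

variable [NeZero n]

lemma inv_mul_apply_T (hq : HasCoords q.val z) (hr : r.val = powConv p n lam (x * q.val 1)) :
    (q⁻¹ * r).val (T p n lam) = x := by
  have h := conv_apply_T q.val (q⁻¹ * r).val
  rw [← Units.val_mul, mul_inv_cancel_left, hr, powConv_T, hq.apply_T, zero_mul, zero_add] at h
  linear_combination (-z 0) * h + (x - (q⁻¹ * r).val (T p n lam)) * hq.mul_apply_one

lemma coord_inv_mul (hq : HasCoords q.val z) (hr : r.val = powConv p n lam (x * q.val 1))
    (hx : x ^ p ^ n = z 1) {k : ℕ} (hk : k < p ^ n) : coord (q⁻¹ * r) k = z k := by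
  have hratio : ratio (q⁻¹ * r) = x * q.val 1 := ratio_eq_of_mul_apply_one (by
    rw [hq.inv_mul_apply_one hr, hq.inv_mul_apply_T hr, mul_assoc, mul_comm (q.val 1),
      hq.mul_apply_one, mul_one])
  have hquot : quot (q⁻¹ * r) = q.val := by
    rw [quot, hratio, ← hr]
    change r.val * (q⁻¹ * r)⁻¹.val = q.val
    rw [← Units.val_mul, mul_inv_rev, inv_inv, mul_inv_cancel_left]
  match k with
  | 0 => exact hq.inv_mul_apply_one hr
  | 1 =>
    change (q⁻¹ * r).val (T p n lam) ^ p ^ n = _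
    rw [hq.inv_mul_apply_T hr, hx]
  | k + 2 =>
    rw [hq.eq_mul_apply _ (by omega) hk, ← hq.inv_mul_apply_one hr, ← hquot]
    rfl

end HasCoords

lemma IsAdmissible.exists_coord_eq [NeZero n] {z : ℕ → D} (hz : IsAdmissible p n lam z) {x : D}
    (hx : x ^ p ^ n = z 1) :
    ∃ a : (GroupAlgebra p n lam D)ˣ, a.val (T p n lam) = x ∧ ∀ k < p ^ n, coord a k = z k := by
  obtain ⟨q, hq⟩ := HasCoords.exists_of_isUnit (p := p) (n := n) (lam := lam) hz.isUnit_zero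
  have hzx : IsUnit (z 0 + lam • x) := by
    refine (isUnit_pow_iff (pow_ne_zero n (Fact.out : p.Prime).ne_zero)).1 ?_
    rw [add_pow_p (R := R), _root_.smul_pow, hx]
    exact hz.isUnit_zero_pow_add
  have hr : IsUnit (1 + lam • (x * q 1)) := by
    refine isUnit_of_mul_isUnit_right (x := z 0) ?_
    rwa [mul_add, mul_one, mul_smul_comm, mul_left_comm, hq.mul_apply_one, mul_one]
  obtain ⟨q, rfl⟩ := hq.isUnit hz
  obtain ⟨r, hr⟩ := isUnit_powConv (p := p) (n := n) hr
  exact ⟨q⁻¹ * r, hq.inv_mul_apply_T hr, fun _ hk => hq.coord_inv_mul hr hx hk⟩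

lemma coord_map [NeZero n] [Algebra (ZMod p) R'] [Algebra R' E]
    (F : GroupAlgebra p n lam D →* GroupAlgebra p n lam' E) (f : D →+* E)
    (hF : ∀ b, ∀ k < p ^ n, F b (T p n lam' ^ k) = f (b (T p n lam ^ k)))
    (a : (GroupAlgebra p n lam D)ˣ) {k : ℕ} (hk : k < p ^ n) :
    coord (Units.map F a) k = f (coord a k) := by
  have hone (b) : F b 1 = f (b 1) := by
    simpa using hF b 0 (pow_pos (Fact.out : p.Prime).pos n)
  have hT (b) : F b (T p n lam') = f (b (T p n lam)) := by
    simpa using hF b 1 (Nat.one_lt_pow (NeZero.ne n) (Fact.out : p.Prime).one_lt)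
  have hratio : ratio (Units.map F a) = f (ratio a) := by
    rw [ratio.eq_def a, map_mul, ← hT, ← hone]
    rfl
  have hpow (u : D) : F (powConv p n lam u) = powConv p n lam' (f u) :=
    conv_ext fun j hj => by rw [hF _ j hj, powConv_T_pow _ hj, powConv_T_pow _ hj, map_pow]
  have hquot : quot (Units.map F a) = F (quot a) := by
    rw [quot, quot, map_mul, hpow, hratio]
    rfl
  match k with
  | 0 => exact hone a.val
  | 1 =>
    change F a.val (T p n lam') ^ p ^ n = f (a.val (T p n lam) ^ p ^ n)
    rw [hT, map_pow]
  | k + 2 =>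
    change F a.val 1 ^ (k + 3) * quot (Units.map F a) _ =
      f (a.val 1 ^ (k + 3) * quot a (T p n lam ^ (k + 2)))
    rw [hquot, hF _ _ hk, hone, map_mul, map_pow f]

end Admissible

section Cover

open Polynomial

variable {R : Type*} [CommRing R] {p n : ℕ} {lam : R} {D : Type*} [CommRing D] [Algebra R D]

lemma aeval_zvar (z : ℕ → D) {k : ℕ} (hk : k < p ^ n) :
    MvPolynomial.aeval (fun i : Fin (p ^ n) => z i) (zvar R p n k) = z k := by
  rw [zvar, dif_pos hk, MvPolynomial.aeval_X]

lemma aeval_zden (z : ℕ → D) {s : ℕ} (hs : s < p ^ n) :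
    MvPolynomial.aeval (fun i : Fin (p ^ n) => z i) (zden p n lam s) = den lam z s :=
  (map_den _ (zvar R p n) s).trans (den_congr fun _ hk => aeval_zvar z (hk.trans_lt hs))

lemma zRing_algHom_ext {f f' : ZRing p n lam →ₐ[R] D}
    (h : ∀ k < p ^ n, f (ZT p n lam k) = f' (ZT p n lam k)) : f = f' := by
  refine IsLocalization.algHom_ext (Submonoid.powers (zvar R p n 0 *
    (zvar R p n 0 ^ p ^ n + lam ^ p ^ n • zvar R p n 1) *
      ∏ s ∈ Finset.Ico 2 (p ^ n), zden p n lam s)) (MvPolynomial.algHom_ext fun i => ?_)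
  have hz : ZT p n lam i = algebraMap _ _ (MvPolynomial.X i) := congrArg _ (dif_pos i.2)
  have := h i i.2
  rwa [hz] at this

variable (p n lam) in
lemma isAdmissible_ZT : IsAdmissible p n lam (ZT p n lam) := by
  have h : IsUnit (IsScalarTower.toAlgHom R _ (ZRing p n lam) (zvar R p n 0 *
      (zvar R p n 0 ^ p ^ n + lam ^ p ^ n • zvar R p n 1) *
        ∏ s ∈ Finset.Ico 2 (p ^ n), zden p n lam s)) :=
    IsLocalization.Away.algebraMap_isUnit _
  rw [map_mul, map_mul, map_add, map_pow, map_smul, map_prod, IsUnit.mul_iff, IsUnit.mul_iff,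
    IsUnit.prod_iff] at h
  refine ⟨h.1.1, h.1.2, fun s hs hsN => ?_⟩
  exact map_den (IsScalarTower.toAlgHom R _ (ZRing p n lam)) (zvar R p n) s ▸
    h.2 s (Finset.mem_Ico.2 ⟨hs, hsN⟩)

variable [Fact p.Prime] [NeZero n]

lemma IsAdmissible.isUnit_aeval {z : ℕ → D} (hz : IsAdmissible p n lam z) :
    IsUnit (MvPolynomial.aeval (fun i : Fin (p ^ n) => z i) (zvar R p n 0 *
      (zvar R p n 0 ^ p ^ n + lam ^ p ^ n • zvar R p n 1) *
        ∏ s ∈ Finset.Ico 2 (p ^ n), zden p n lam s)) := by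
  have h1 : 1 < p ^ n := Nat.one_lt_pow (NeZero.ne n) (Fact.out : p.Prime).one_lt
  rw [map_mul, map_mul, map_add, map_pow, map_smul, map_prod, aeval_zvar _ (zero_lt_one.trans h1),
    aeval_zvar _ h1]
  refine (hz.isUnit_zero.mul hz.isUnit_zero_pow_add).mul (IsUnit.prod_iff.2 fun s hs => ?_)
  obtain ⟨hs, hsN⟩ := Finset.mem_Ico.1 hs
  rw [aeval_zden z hsN]
  exact hz.isUnit_den s hs hsN

/-- The point of the spectrum of `ZRing` given by an admissible sequence. -/
def IsAdmissible.lift {z : ℕ → D} (hz : IsAdmissible p n lam z) : ZRing p n lam →ₐ[R] D :=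
  IsLocalization.Away.liftAlgHom _ hz.isUnit_aeval

lemma IsAdmissible.lift_ZT {z : ℕ → D} (hz : IsAdmissible p n lam z) {k : ℕ} (hk : k < p ^ n) :
    hz.lift (ZT p n lam k) = z k :=
  (IsLocalization.Away.lift_eq _ hz.isUnit_aeval _).trans (aeval_zvar _ hk)

variable [Algebra (ZMod p) R]

variable (p n lam) in
/-- The map `R[Z_1^{±1}, Z_T, …] → S` of the theorem. -/
def zHom : ZRing p n lam →ₐ[R] SLambda p n lam :=
  (isAdmissible_coord (UnitScheme.genUnit (basis p n lam))).lift

lemma zHom_ZT {k : ℕ} (hk : k < p ^ n) :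
    zHom p n lam (ZT p n lam k) = coord (UnitScheme.genUnit (basis p n lam)) k :=
  IsAdmissible.lift_ZT _ hk

lemma coord_convMap {E : Type*} [CommRing E] [Algebra R E] (f : D →ₐ[R] E)
    (a : (GroupAlgebra p n lam D)ˣ) {k : ℕ} (hk : k < p ^ n) :
    coord (Units.map (convMap (C := ALambda p n lam) f) a) k = f (coord a k) :=
  coord_map (convMap (C := ALambda p n lam) f) (f : D →+* E) (fun _ _ _ => rfl) a hk

lemma coord_map_coaction_genUnit (lam : R) {k : ℕ} (hk : k < p ^ n) :
    coord (Units.map (convMap (UnitScheme.coaction (basis p n lam)))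
      (UnitScheme.genUnit (basis p n lam))) k =
      coord (UnitScheme.genUnit (basis p n lam)) k ⊗ₜ[R] (1 : ALambda p n lam) := by
  let t : SLambda p n lam ⊗[R] ALambda p n lam := 1 ⊗ₜ[R] T p n lam
  have ht : t ^ p ^ n = 0 := by
    rw [Algebra.TensorProduct.tmul_pow, T_pow, TensorProduct.tmul_zero]
  have hχ : toConv (Algebra.TensorProduct.includeRight :
      ALambda p n lam →ₐ[R] SLambda p n lam ⊗[R] ALambda p n lam).toLinearMap =
        powConv p n lam t := by
    rw [powConv_of_pow_eq_zero ht]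
    congr 2
    exact hom_ext (by rw [lift_T]; rfl)
  obtain ⟨χ, hχ'⟩ := isUnit_powConv (p := p) (n := n) (lam := lam)
    (IsNilpotent.smul ⟨_, ht⟩ lam).isUnit_one_add
  have h : Units.map (convMap (UnitScheme.coaction (basis p n lam)))
      (UnitScheme.genUnit (basis p n lam)) =
      Units.map (convMap Algebra.TensorProduct.includeLeft)
        (UnitScheme.genUnit (basis p n lam)) * χ := by
    refine Units.ext ?_
    rw [Units.val_mul, hχ', ← hχ]
    exact UnitScheme.convMap_coaction_genUnit _
  rw [h, coord_mul_powConv _ ht hχ', coord_convMap _ _ hk]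
  rfl

lemma zHom_mem_coinvLambda (x : ZRing p n lam) : zHom p n lam x ∈ coinvLambda p n lam := by
  have h : (UnitScheme.coaction (basis p n lam)).comp (zHom p n lam) =
      Algebra.TensorProduct.includeLeft.comp (zHom p n lam) :=
    zRing_algHom_ext fun k hk => by
      rw [AlgHom.comp_apply, AlgHom.comp_apply, zHom_ZT hk, ← coord_convMap _ _ hk,
        coord_map_coaction_genUnit lam hk]
      rfl
  exact DFunLike.congr_fun h x

end Cover

end ALambda

section AdjoinRoot

open Polynomial

variable {B : Type*} [CommRing B] {N : ℕ} {b : B}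

lemma injective_adjoinRoot_of_X_pow_sub_C (hN : N ≠ 0) :
    Function.Injective (AdjoinRoot.of (X ^ N - C b)) := by
  nontriviality B
  refine (injective_iff_map_eq_zero _).2 fun z hz => ?_
  by_contra hz0
  refine (monic_X_pow_sub_C b hN).not_dvd_of_natDegree_lt (C_ne_zero.2 hz0) ?_
    (AdjoinRoot.mk_eq_zero.1 hz)
  rw [natDegree_C, natDegree_X_pow_sub_C]
  exact Nat.pos_of_ne_zero hN

lemma adjoinRoot_root_X_pow_sub_C_pow :
    AdjoinRoot.root (X ^ N - C b) ^ N = AdjoinRoot.of _ b := by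
  have h := AdjoinRoot.eval₂_root (X ^ N - C b)
  rwa [eval₂_sub, eval₂_pow, eval₂_X, eval₂_C, sub_eq_zero] at h

lemma exists_natDegree_lt_adjoinRoot_mk_eq (hN : N ≠ 0) (y : AdjoinRoot (X ^ N - C b)) :
    ∃ q : B[X], q.natDegree < N ∧ AdjoinRoot.mk _ q = y := by
  obtain ⟨r, rfl⟩ := AdjoinRoot.mk_surjective y
  cases subsingleton_or_nontrivial B with
  | inl _ => exact ⟨0, Nat.pos_of_ne_zero hN, congrArg _ (Subsingleton.elim _ _)⟩
  | inr _ =>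
    have monic := monic_X_pow_sub_C b hN
    have natDegree_eq : (X ^ N - C b).natDegree = N := natDegree_X_pow_sub_C
    refine ⟨r %ₘ (X ^ N - C b), ?_, ?_⟩
    · refine (natDegree_modByMonic_lt r monic fun h => hN ?_).trans_eq natDegree_eq
      rw [← natDegree_eq, h, natDegree_one]
    · rw [← AdjoinRoot.modByMonicHom_mk monic, AdjoinRoot.mk_leftInverse]

end AdjoinRoot

namespace ALambda

open Polynomial

variable {R : Type*} [CommRing R] {p n : ℕ} [Fact p.Prime] [NeZero n] [Algebra (ZMod p) R]
  {lam : R} {D : Type*} [CommRing D] [Algebra R D]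

lemma sLambda_algHom_ext {f f' : SLambda p n lam →ₐ[R] D}
    (hX : f (XT p n lam 1) = f' (XT p n lam 1))
    (hZ : f.comp (zHom p n lam) = f'.comp (zHom p n lam)) : f = f' := by
  refine UnitScheme.algHom_ext_of_genUnit _ (eq_of_coord_eq ?_ fun k hk => ?_)
  · rwa [XT, pow_one] at hX
  · rw [coord_convMap _ _ hk, coord_convMap _ _ hk, ← zHom_ZT hk]
    exact DFunLike.congr_fun hZ _

lemma exists_sLambda_algHom (φ : ZRing p n lam →ₐ[R] D) {x : D}
    (hx : x ^ p ^ n = φ (ZT p n lam 1)) :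
    ∃ f : SLambda p n lam →ₐ[R] D, f (XT p n lam 1) = x ∧ f.comp (zHom p n lam) = φ := by
  obtain ⟨a, rfl, ha⟩ := ((isAdmissible_ZT p n lam).map φ).exists_coord_eq hx
  have hf := UnitScheme.map_liftUnit_genUnit (basis p n lam) a
  refine ⟨UnitScheme.liftUnit (basis p n lam) a, ?_, zRing_algHom_ext fun k hk => ?_⟩
  · rw [XT, pow_one]
    exact congrArg (fun u : (GroupAlgebra p n lam D)ˣ => u.val (T p n lam)) hf
  · rw [AlgHom.comp_apply, zHom_ZT hk, ← coord_convMap _ _ hk, hf, ha k hk, Function.comp_apply]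

variable (p n lam) in
/-- The extension of `ZRing` by a `p ^ n`-th root of `Z_T`; it is isomorphic to `SLambda`, with
`X_T` as the root. -/
abbrev Cover : Type _ := AdjoinRoot (X ^ p ^ n - C (ZT p n lam 1))

variable (p n lam) in
lemma exists_algHom_cover : ∃ f : SLambda p n lam →ₐ[R] Cover p n lam,
    f (XT p n lam 1) = AdjoinRoot.root _ ∧ f.comp (zHom p n lam) = AdjoinRoot.ofAlgHom R _ :=
  exists_sLambda_algHom (AdjoinRoot.ofAlgHom R _)
    adjoinRoot_root_X_pow_sub_C_pow

variable (p n lam) in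
lemma zHom_injective : Function.Injective (zHom p n lam) := by
  obtain ⟨f, -, hf⟩ := exists_algHom_cover p n lam
  have h : Function.Injective (f.comp (zHom p n lam)) := hf ▸
    injective_adjoinRoot_of_X_pow_sub_C (pow_ne_zero n (Fact.out : p.Prime).ne_zero)
  exact .of_comp h

lemma exists_eq_eval₂_zHom (y : SLambda p n lam) : ∃ q : (ZRing p n lam)[X],
    q.natDegree < p ^ n ∧
      q.eval₂ (zHom p n lam : ZRing p n lam →+* SLambda p n lam) (XT p n lam 1) = y := by
  have h1 : 1 < p ^ n := Nat.one_lt_pow (NeZero.ne n) (Fact.out : p.Prime).one_lt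
  obtain ⟨f, hfX, hfZ⟩ := exists_algHom_cover p n lam
  have hroot : (X ^ p ^ n - C (ZT p n lam 1)).eval₂
      (zHom p n lam : ZRing p n lam →+* SLambda p n lam) (XT p n lam 1) = 0 := by
    rw [eval₂_sub, eval₂_pow, eval₂_X, eval₂_C, sub_eq_zero, XT, pow_one]
    exact (zHom_ZT h1).symm
  let f' : Cover p n lam →ₐ[R] SLambda p n lam :=
    AdjoinRoot.liftAlgHom _ (zHom p n lam) (XT p n lam 1) hroot
  have hff' : f'.comp f = AlgHom.id R _ := by
    refine sLambda_algHom_ext ?_ ?_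
    · rw [AlgHom.comp_apply, hfX, AdjoinRoot.liftAlgHom_root, AlgHom.id_apply]
    · rw [AlgHom.comp_assoc, hfZ]
      exact AlgHom.ext fun z => AdjoinRoot.liftAlgHom_of _ (zHom p n lam) _ hroot z
  obtain ⟨q, hqN, hq⟩ := exists_natDegree_lt_adjoinRoot_mk_eq (zero_lt_one.trans h1).ne' (f y)
  refine ⟨q, hqN, ?_⟩
  calc _ = f' (AdjoinRoot.mk _ q) := (AdjoinRoot.liftAlgHom_mk _ _ _ _ _).symm
    _ = y := by
      rw [hq]
      exact DFunLike.congr_fun hff' y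

end ALambda

section LinearSubstitution

open Polynomial

variable {S E : Type*} [CommRing S] [CommRing E] [Algebra S E] {t : E} {N : ℕ}

lemma eq_zero_of_aeval_eq_zero_of_linearIndependent
    (ht : LinearIndependent S fun i : Fin N => t ^ (i : ℕ)) {Q : S[X]} (hQ : Q.natDegree < N)
    (h : aeval t Q = 0) : Q = 0 := by
  rw [aeval_eq_sum_range' hQ, Finset.sum_range] at h
  have hcoeff := Fintype.linearIndependent_iff.1 ht (fun i => Q.coeff i) h
  ext k
  by_cases hk : k < N
  · exact hcoeff ⟨k, hk⟩
  · exact coeff_eq_zero_of_natDegree_lt (hQ.trans_le (not_lt.1 hk))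

lemma eq_C_of_aeval_smul_add_algebraMap
    (ht : LinearIndependent S fun i : Fin N => t ^ (i : ℕ)) {u : S} (hu : IsUnit u) {x y : S}
    {Q : S[X]} (hQ : Q.natDegree < N) (h : aeval (u • t + algebraMap S E x) Q = algebraMap S E y) :
    Q = C y := by
  obtain ⟨v, huv⟩ := hu.exists_right_inv
  have comp_eq : Q.comp (C u * X + C x) = C y := by
    refine sub_eq_zero.1 (eq_zero_of_aeval_eq_zero_of_linearIndependent ht ?_ ?_)
    · rw [natDegree_sub_C]
      calc _ ≤ Q.natDegree * (C u * X + C x).natDegree := natDegree_comp_le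
        _ ≤ Q.natDegree * 1 := Nat.mul_le_mul_left _ natDegree_linear_le
        _ < N := by rwa [mul_one]
    · rw [map_sub, aeval_comp, aeval_C, map_add, map_mul, aeval_C, aeval_C, aeval_X,
        ← Algebra.smul_def, h, sub_self]
  have inverse : (C u * X + C x).comp (C v * (X - C x)) = X := by
    simp only [add_comp, mul_comp, C_comp, X_comp]
    rw [← mul_assoc, ← C_mul, huv, C_1, one_mul, sub_add_cancel]
  rw [← comp_X (p := Q), ← inverse, ← comp_assoc, comp_eq, C_comp]

end LinearSubstitution

namespace ALambda

section Coinvariants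

open Polynomial

variable {R : Type*} [CommRing R] {p n : ℕ} [Fact p.Prime] {lam : R}

lemma linearIndependent_one_tmul_T_pow (S : Type*) [CommRing S] [Algebra R S] :
    LinearIndependent S fun i : Fin (p ^ n) =>
      ((1 : S) ⊗ₜ[R] T p n lam) ^ (i : ℕ) := by
  convert (Algebra.TensorProduct.basis S (basis p n lam)).linearIndependent using 2 with i
  rw [Algebra.TensorProduct.basis_apply, basis_apply, Algebra.TensorProduct.tmul_pow, one_pow]

variable [Algebra (ZMod p) R]

variable (p n lam) in
lemma coaction_XT_one : UnitScheme.coaction (basis p n lam) (XT p n lam 1) =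
    (XT p n lam 0 + lam • XT p n lam 1) • (1 ⊗ₜ[R] T p n lam) +
      algebraMap (SLambda p n lam) _ (XT p n lam 1) := by
  have h : UnitScheme.coaction (basis p n lam) (UnitScheme.genS _ (T p n lam)) =
      UnitScheme.genS _ (T p n lam) ⊗ₜ[R] 1 * 1 ⊗ₜ[R] g p n lam +
        UnitScheme.genS _ 1 ⊗ₜ[R] 1 * 1 ⊗ₜ[R] T p n lam :=
    (congrArg (fun a : GroupAlgebra p n lam _ => a (T p n lam))
      (UnitScheme.convMap_coaction_genUnit (basis p n lam))).trans (conv_apply_T _ _)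
  rw [XT, XT, pow_one, pow_zero, h, g, Algebra.TensorProduct.algebraMap_apply]
  simp only [mul_add, Algebra.TensorProduct.tmul_mul_tmul, one_mul, mul_one,
    TensorProduct.tmul_add, TensorProduct.tmul_smul, TensorProduct.smul_tmul', add_smul,
    smul_eq_mul, mul_smul_comm, Algebra.algebraMap_self, RingHom.id_apply]
  abel

variable [NeZero n]

lemma coaction_eval₂_zHom (q : (ZRing p n lam)[X]) :
    UnitScheme.coaction (basis p n lam)
        (q.eval₂ (zHom p n lam : ZRing p n lam →+* SLambda p n lam) (XT p n lam 1)) =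
      aeval ((XT p n lam 0 + lam • XT p n lam 1) • (1 ⊗ₜ[R] T p n lam) +
        algebraMap (SLambda p n lam) (SLambda p n lam ⊗[R] ALambda p n lam) (XT p n lam 1))
        (q.map (zHom p n lam : ZRing p n lam →+* SLambda p n lam)) := by
  have coaction_comp_zHom : ((UnitScheme.coaction (basis p n lam)).toRingHom).comp
      (zHom p n lam : ZRing p n lam →+* SLambda p n lam) =
        (algebraMap (SLambda p n lam) (SLambda p n lam ⊗[R] ALambda p n lam)).comp
          (zHom p n lam : ZRing p n lam →+* SLambda p n lam) :=
    RingHom.ext fun z => by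
      rw [RingHom.comp_apply, RingHom.comp_apply, Algebra.TensorProduct.algebraMap_apply]
      exact zHom_mem_coinvLambda z
  rw [← coaction_XT_one, aeval_def, eval₂_map, ← coaction_comp_zHom]
  exact hom_eval₂ q _ (UnitScheme.coaction (basis p n lam)).toRingHom _

lemma exists_zHom_eq {y : SLambda p n lam} (hy : y ∈ coinvLambda p n lam) :
    ∃ z, zHom p n lam z = y := by
  obtain ⟨q, hqN, rfl⟩ := exists_eq_eval₂_zHom y
  have isUnit_ell : IsUnit (XT p n lam 0 + lam • XT p n lam 1) := by
    rw [XT, XT, pow_zero, pow_one]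
    exact isUnit_apply_one_add_smul_apply_T (UnitScheme.genUnit (basis p n lam))
  have hq := eq_C_of_aeval_smul_add_algebraMap
    (linearIndependent_one_tmul_T_pow (lam := lam) (SLambda p n lam)) isUnit_ell
    (natDegree_map_le.trans_lt hqN) ((coaction_eval₂_zHom q).symm.trans hy)
  exact ⟨q.coeff 0, by simpa using congrArg (coeff · 0) hq⟩

variable (p n lam) in
/-- The isomorphism of the theorem. -/
def zEquiv : ZRing p n lam ≃ₐ[R] coinvLambda p n lam :=
  .ofBijective ((zHom p n lam).codRestrict _ zHom_mem_coinvLambda)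
    ⟨fun _ _ h => zHom_injective p n lam (congrArg Subtype.val h),
      fun y => (exists_zHom_eq y.2).imp fun _ h => Subtype.ext h⟩

lemma coe_zEquiv_ZT {k : ℕ} (hk : k < p ^ n) :
    (zEquiv p n lam (ZT p n lam k) : SLambda p n lam) =
      coord (UnitScheme.genUnit (basis p n lam)) k :=
  zHom_ZT hk

end Coinvariants

section BaseChange

variable {R R' : Type*} [CommRing R] [CommRing R'] [Algebra R R'] {p n : ℕ} {lam : R} {lam' : R'}
  {D : Type*} [CommRing D] [Algebra R D] [Algebra R' D]

lemma apply_g_pow_mul_T_pow {M : Type*} [AddCommGroup M] [Module R M] (a : ALambda p n lam →ₗ[R] M)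
    (i m : ℕ) : a (g p n lam ^ i * T p n lam ^ m) =
      ∑ k ∈ Finset.range (i + 1), (i.choose k * lam ^ k : R) • a (T p n lam ^ (k + m)) := by
  simpa only [LinearMap.comp_apply, LinearMap.mulRight_apply, pow_add] using
    apply_g_pow (a ∘ₗ LinearMap.mulRight R (T p n lam ^ m)) i

variable [IsScalarTower R R' D]

lemma apply_g_pow_mul_T_pow_congr (h : algebraMap R R' lam = lam') {a : ALambda p n lam →ₗ[R] D}
    {a' : ALambda p n lam' →ₗ[R'] D} (ha : ∀ k < p ^ n, a (T p n lam ^ k) = a' (T p n lam' ^ k))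
    {i m : ℕ} (him : i + m < p ^ n) :
    a (g p n lam ^ i * T p n lam ^ m) = a' (g p n lam' ^ i * T p n lam' ^ m) := by
  rw [apply_g_pow_mul_T_pow, apply_g_pow_mul_T_pow]
  refine Finset.sum_congr rfl fun k hk => ?_
  rw [Finset.mem_range] at hk
  rw [ha _ (by omega), ← algebraMap_smul R' (i.choose k * lam ^ k : R), map_mul, map_natCast,
    map_pow, h]

variable [Fact p.Prime] [Algebra (ZMod p) R] [Algebra (ZMod p) R']

/-- Restriction of functionals along `A^(λ) → A^(λ')`, `T ↦ T`, where `λ'` is the image of `λ`. -/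
def restrict (h : algebraMap R R' lam = lam') :
    GroupAlgebra p n lam' D →* GroupAlgebra p n lam D where
  toFun a := ofValues p n lam fun k => a (T p n lam' ^ k)
  map_one' := conv_ext fun k hk => by
    simp [ofValues_T_pow _ hk, LinearMap.convOne_apply, counit_T]
  map_mul' a c := conv_ext fun j hj => by
    rw [ofValues_T_pow _ hj, conv_apply_T_pow, conv_apply_T_pow]
    refine Finset.sum_congr rfl fun i hi => ?_
    have hij : i ≤ j := Nat.lt_succ_iff.1 (Finset.mem_range.1 hi)
    rw [ofValues_T_pow _ (hij.trans_lt hj),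
      apply_g_pow_mul_T_pow_congr (a' := c.ofConv) h (fun k hk => ofValues_T_pow _ hk)
        ((Nat.add_sub_cancel' hij).trans_lt hj)]

lemma restrict_T_pow (h : algebraMap R R' lam = lam') (a : GroupAlgebra p n lam' D) {k : ℕ}
    (hk : k < p ^ n) : restrict h a (T p n lam ^ k) = a (T p n lam' ^ k) :=
  ofValues_T_pow (fun k => a (T p n lam' ^ k)) hk

variable (p n) in
/-- The base change map `S(A^(λ))_Θ → S(A^(λ'))_Θ`, `X_{T^s} ↦ X_{T^s}`, where `λ'` is the image
of `λ`. -/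
def baseChange (h : algebraMap R R' lam = lam') : SLambda p n lam →ₐ[R] SLambda p n lam' :=
  UnitScheme.liftUnit (basis p n lam)
    (Units.map (restrict h) (UnitScheme.genUnit (basis p n lam')))

lemma baseChange_XT (h : algebraMap R R' lam = lam') {k : ℕ} (hk : k < p ^ n) :
    baseChange p n h (XT p n lam k) = XT p n lam' k := by
  rw [XT, baseChange, UnitScheme.liftUnit_genS]
  exact restrict_T_pow h _ hk

lemma baseChange_coord_genUnit [NeZero n] (h : algebraMap R R' lam = lam') {k : ℕ}
    (hk : k < p ^ n) :
    baseChange p n h (coord (UnitScheme.genUnit (basis p n lam)) k) =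
      coord (UnitScheme.genUnit (basis p n lam')) k := by
  rw [← coord_convMap _ _ hk, baseChange, UnitScheme.map_liftUnit_genUnit]
  exact coord_map (restrict h) (RingHom.id _) (fun a _ => restrict_T_pow h a) _ hk

end BaseChange

section Generic

open Polynomial

variable {R : Type*} [CommRing R] (p n : ℕ) [Fact p.Prime] [Algebra (ZMod p) R] (lam : R)

lemma exists_isSubstitution [NeZero n] :
    ∃ σ : SLambda p n (X : R[X]) →+* SLambda p n lam, IsSubstitution p n lam σ ∧
      ∀ k < p ^ n, σ (coord (UnitScheme.genUnit (basis p n (X : R[X]))) k) =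
        coord (UnitScheme.genUnit (basis p n lam)) k := by
  let _ : Algebra R[X] R := (evalRingHom lam).toAlgebra
  have h : algebraMap R[X] R X = lam := eval_X
  refine ⟨baseChange p n h, ⟨fun f => ?_, fun s hs => baseChange_XT h hs⟩,
    fun k hk => baseChange_coord_genUnit h hk⟩
  exact (baseChange p n h).commutes f

lemma ell_eq (s : ℕ) : ell p n lam s = UnitScheme.genS (basis p n lam) (g p n lam ^ s) :=
  (apply_g_pow _ s).symm

lemma isGenericP_coord_genUnit [NeZero n] :
    IsGenericP R p n (coord (UnitScheme.genUnit (basis p n (X : R[X])))) := by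
  intro s hs hsN
  have h := den_coord_mul_apply_g_pow (UnitScheme.genUnit (basis p n (X : R[X]))) hs hsN
  rw [den, add_mul] at h
  rw [ell_eq, XT, XT, pow_zero, pow_one]
  exact eq_sub_of_add_eq' h

end Generic

end ALambda

end

theorem theorem3p7 (p n : ℕ) [Fact p.Prime] (hn : 0 < n) {R : Type*} [CommRing R]
    [Algebra (ZMod p) R] (lam : R) :
    ∃ (σ : SLambda p n (Polynomial.X : Polynomial R) →+* SLambda p n lam)
      (P : ℕ → SLambda p n (Polynomial.X : Polynomial R))
      (e : ZRing p n lam ≃ₐ[R] coinvLambda p n lam),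
      IsSubstitution p n lam σ ∧
      IsGenericP R p n P ∧
      (e (ZT p n lam 0) : SLambda p n lam) = XT p n lam 0 ∧
      (e (ZT p n lam 1) : SLambda p n lam) = XT p n lam 1 ^ p ^ n ∧
      ∀ s, 2 ≤ s → s < p ^ n → (e (ZT p n lam s) : SLambda p n lam) = σ (P s) := by
  have : NeZero n := ⟨hn.ne'⟩
  have one_lt : 1 < p ^ n := Nat.one_lt_pow hn.ne' (Fact.out : p.Prime).one_lt
  obtain ⟨σ, hσ, hσ_coord⟩ := ALambda.exists_isSubstitution p n lam
  refine ⟨σ, _, ALambda.zEquiv p n lam, hσ, ALambda.isGenericP_coord_genUnit p n, ?_, ?_, ?_⟩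
  · exact ALambda.coe_zEquiv_ZT (zero_lt_one.trans one_lt)
  · rw [ALambda.coe_zEquiv_ZT one_lt, XT, pow_one]
    rfl
  · intro s _ hs
    rw [ALambda.coe_zEquiv_ZT hs, hσ_coord s hs]
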